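/- Let $0<\epsilon<1$, $\delta>\epsilon$ and $\sigma\ge 0$ be fixed. For $M>0$ and integers $n,p\ge 1$, let $y=X\beta+z$, where $X\in\mathbb{R}^{n\times p}$ has i.i.d. $\mathcal N(0,1/n)$ entries, $z\in\mathbb{R}^n$ has i.i.d. $\mathcal N(0,\sigma^2)$ entries ($z=0$ if $\sigma=0$), the coefficients $\beta_1,\dots,\beta_p$ are i.i.d., equal to $M$ with probability $\epsilon$ and to $0$ with probability $1-\epsilon$, and $X,\beta,z$ are independent. For $\lambda>0$ let $\widehat\beta$ be an $\ell_0$-penalized least-squares estimate, that is, any minimizer over $b\in\mathbb{R}^p$ of $$\|y-Xb\|_2^2+\lambda\,\|b\|_0,\qquad \|b\|_0=\#\{j: b_j\ne 0\},$$ and put $$\mathrm{FDP}=\frac{\#\{j:\widehat\beta_j\ne 0,\ \beta_j=0\}}{\max(\#\{j:\widehat\beta_j\ne 0\},1)},\qquad \mathrm{TPP}=\frac{\#\{j:\widehat\beta_j\ne 0,\ \beta_j\ne 0\}}{\max(\#\{j:\beta_j\ne 0\},1)}.$$ Then there is a choice of penalties $\lambda(M)>0$, depending only on $M,\epsilon,\delta,\sigma$,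 such that, for the estimates with $\lambda=\lambda(M)$, $$\lim_{M\to\infty}\ \lim_{n,p\to\infty,\ n/p\to\delta}\mathrm{FDP}=0\quad\text{and}\quad \lim_{M\to\infty}\ \lim_{n,p\to\infty,\ n/p\to\delta}\mathrm{TPP}=1\quad\text{in probability},$$ in the following sense: for every $\eta>0$ there is $M_0$ such that for every fixed $M\ge M_0$, as $n,p\to\infty$ with $n/p\to\delta$, the probability that some minimizer $\widehat\beta$ has $\mathrm{FDP}\ge\eta$, and the probability that some minimizer has $|\mathrm{TPP}-1|\ge\eta$, both tend to $0$. -/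

import Mathlib

open Filter Topology MeasureTheory ProbabilityTheory
open scoped NNReal

namespace L0Selection

noncomputable section

/-- The number of nonzero coordinates, `‖b‖₀`. -/
def l0norm {p : ℕ} (b : Fin p → ℝ) : ℕ :=
  (Finset.univ.filter fun j => b j ≠ 0).card

/-- The number of false discoveries, `V = #{j : b j ≠ 0 and β j = 0}`. -/
def falseDiscoveries {p : ℕ} (β b : Fin p → ℝ) : ℕ :=
  (Finset.univ.filter fun j => b j ≠ 0 ∧ β j = 0).card

/-- The number of true discoveries, `T = #{j : b j ≠ 0 and β j ≠ 0}`. -/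
def trueDiscoveries {p : ℕ} (β b : Fin p → ℝ) : ℕ :=
  (Finset.univ.filter fun j => b j ≠ 0 ∧ β j ≠ 0).card

/-- The false discovery proportion `V / (#{j : b j ≠ 0} ∨ 1)` of an estimate `b` of `β`. -/
def FDP {p : ℕ} (β b : Fin p → ℝ) : ℝ :=
  (falseDiscoveries β b : ℝ) / max (l0norm b : ℝ) 1

/-- The true positive proportion `T / (k ∨ 1)`, `k = #{j : β j ≠ 0}`, of an estimate `b` of `β`. -/
def TPP {p : ℕ} (β b : Fin p → ℝ) : ℝ :=
  (trueDiscoveries β b : ℝ) / max (l0norm β : ℝ) 1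

/-- The objective `‖y - X b‖² + lam * ‖b‖₀`, with the Euclidean norm on `ℝⁿ`. -/
def l0Objective {n p : ℕ} (lam : ℝ) (X : Matrix (Fin n) (Fin p) ℝ) (y : Fin n → ℝ)
    (b : Fin p → ℝ) : ℝ :=
  ∑ i, (y i - X.mulVec b i) ^ 2 + lam * (l0norm b : ℝ)

/-- The set of all minimizers over `ℝᵖ` of the `ℓ₀`-penalized least-squares objective. -/
def l0Argmin {n p : ℕ} (lam : ℝ) (X : Matrix (Fin n) (Fin p) ℝ) (y : Fin n → ℝ) :
    Set (Fin p → ℝ) :=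
  {b | ∀ b' : Fin p → ℝ, l0Objective lam X y b ≤ l0Objective lam X y b'}

/-- The least-squares problem restricted to coefficient vectors supported in `S` has a solution. -/
theorem exists_leastSquares {n p : ℕ} (X : Matrix (Fin n) (Fin p) ℝ) (y : Fin n → ℝ)
    (S : Finset (Fin p)) :
    ∃ b : Fin p → ℝ, (∀ j, j ∉ S → b j = 0) ∧ ∀ b' : Fin p → ℝ, (∀ j, j ∉ S → b' j = 0) →
      ∑ i, (y i - X.mulVec b i) ^ 2 ≤ ∑ i, (y i - X.mulVec b' i) ^ 2 := by
  let W : Submodule ℝ (Fin p → ℝ) :=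
    { carrier := {b | ∀ j, j ∉ S → b j = 0}
      add_mem' := fun {a b} ha hb j hj => by simp [ha j hj, hb j hj]
      zero_mem' := fun j _ => rfl
      smul_mem' := fun c a ha j hj => by simp [ha j hj] }
  let L : (Fin p → ℝ) →ₗ[ℝ] EuclideanSpace ℝ (Fin n) :=
    (WithLp.linearEquiv 2 ℝ (Fin n → ℝ)).symm.toLinearMap ∘ₗ X.mulVecLin
  let U : Submodule ℝ (EuclideanSpace ℝ (Fin n)) := W.map L
  let Y : EuclideanSpace ℝ (Fin n) := WithLp.toLp 2 y
  have hU : IsClosed (U : Set (EuclideanSpace ℝ (Fin n))) := U.closed_of_finiteDimensional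
  obtain ⟨u, hu, hd⟩ := hU.exists_infDist_eq_dist ⟨0, U.zero_mem⟩ Y
  obtain ⟨b, hb, rfl⟩ := hu
  have key : ∀ c : Fin p → ℝ, dist Y (L c) ^ 2 = ∑ i, (y i - X.mulVec c i) ^ 2 := by
    intro c
    rw [EuclideanSpace.dist_eq, Real.sq_sqrt (Finset.sum_nonneg fun i _ => sq_nonneg _)]
    refine Finset.sum_congr rfl fun i _ => ?_
    rw [Real.dist_eq, sq_abs]
    rfl
  refine ⟨b, hb, fun b' hb' => ?_⟩
  rw [← key, ← key]
  have h : dist Y (L b) ≤ dist Y (L b') := by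
    rw [← hd]
    exact Metric.infDist_le_dist_of_mem ⟨b', hb', rfl⟩
  gcongr

/-- For a nonnegative penalty the `ℓ₀` estimator exists, whatever the design and the response. -/
theorem l0Argmin_nonempty {n p : ℕ} {lam : ℝ} (hlam : 0 ≤ lam)
    (X : Matrix (Fin n) (Fin p) ℝ) (y : Fin n → ℝ) : (l0Argmin lam X y).Nonempty := by
  choose f hf hmin using exists_leastSquares X y
  obtain ⟨S, -, hS⟩ := Finset.exists_min_image (Finset.univ : Finset (Finset (Fin p)))
    (fun S => ∑ i, (y i - X.mulVec (f S) i) ^ 2 + lam * (S.card : ℝ)) ⟨∅, Finset.mem_univ _⟩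
  refine ⟨f S, fun b' => ?_⟩
  have h1 : l0norm (f S) ≤ S.card := by
    refine Finset.card_le_card fun j hj => ?_
    by_contra h
    exact (Finset.mem_filter.mp hj).2 (hf S j h)
  have h2 := hS (Finset.univ.filter fun j => b' j ≠ 0) (Finset.mem_univ _)
  have h3 := hmin (Finset.univ.filter fun j => b' j ≠ 0) b' (by simp)
  have h4 : lam * (l0norm (f S) : ℝ) ≤ lam * (S.card : ℝ) := by gcongr
  simp only [l0Objective]
  simp only [l0norm] at h2 h3 h4 ⊢
  linarith

/-- The two-point prior: `M` with probability `ε` and `0` with probability `1 - ε`. -/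
def twoPointPrior (ε M : ℝ) : Measure ℝ :=
  ε.toNNReal • Measure.dirac M + (1 - ε).toNNReal • Measure.dirac 0

/-- A realization `(β, X, z)` of the coefficients, the design matrix and the errors. -/
abbrev Sample (n p : ℕ) : Type :=
  (Fin p → ℝ) × (Fin n → Fin p → ℝ) × (Fin n → ℝ)

/-- The coefficient vector `β`. -/
def Sample.coef {n p : ℕ} (s : Sample n p) : Fin p → ℝ := s.1

/-- The design matrix `X`. -/
def Sample.design {n p : ℕ} (s : Sample n p) : Matrix (Fin n) (Fin p) ℝ := Matrix.of s.2.1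

/-- The response `y = X β + z`. -/
def Sample.response {n p : ℕ} (s : Sample n p) : Fin n → ℝ :=
  s.design.mulVec s.coef + s.2.2

/-- The joint law of `(β, X, z)`: independent, `β` with i.i.d. entries of law `prior`, `X` with
i.i.d. `N(0, 1/n)` entries, `z` with i.i.d. `N(0, σ²)` entries (zero when `σ = 0`). -/
def modelLaw (n p : ℕ) (σ : ℝ≥0) (prior : Measure ℝ) : Measure (Sample n p) :=
  (Measure.pi fun _ => prior).prod
    ((Measure.pi fun _ => Measure.pi fun _ => gaussianReal 0 (1 / (n : ℝ≥0))).prod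
      (Measure.pi fun _ => gaussianReal 0 (σ ^ 2)))

/-- The limit `n, p → ∞` with `n / p → δ`, for pairs `(n, p)`. -/
def proportionalLimit (δ : ℝ) : Filter (ℕ × ℕ) :=
  (atTop ×ˢ atTop) ⊓ comap (fun q : ℕ × ℕ => (q.1 : ℝ) / (q.2 : ℝ)) (𝓝 δ)

end

end L0Selection

/-!
The penalty is `lam M = M`: much larger than the noise level `σ²`, much smaller than the squared
signal size `M²`. Let `T` be the support of `β`, `k = #T`, `S` the support of a minimizer `b`, and
`A = T \ S` the set of missed coordinates.

Comparing the objective at `b` and at `β` gives `‖y - X b‖² + M #S ≤ ‖z‖² + M k`. As `‖z‖²` is of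
order `p`, this already yields `#S ≤ k + O(p / M)`, so that false discoveries are under control as
soon as `#A` is a small fraction of `p`. The nonzero coefficients all equal `M`, so
`y - X b - z = M X 1_A - X v` for some `v` supported in `S`, and the same inequality shows that
`X 1_A` is within squared distance `O(p / M)` of the column space of `X_S`
(`l0Argmin_missed_near`).

On the other hand `X 1_A` is an `N(0, #A / n)` vector independent of `X_S`, so its squared distance
to that space is `#A / n` times a chi-square variable with at least `n - #S` degrees of freedom.
Such a variable is below `n / θ` with probability at most `exp (n - L (n - #S))`, where `L → ∞` as
`θ → ∞` (`design_near_le`). Since `#S ≤ (ε + o(1)) p` and `n ≈ δ p` with `δ > ε`, the exponent is at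
most `2 δ p - L c p` for a constant `c > 0`, and for `L` large enough, depending only on `δ` and
`ε`, this beats the `4 ^ p` pairs `(S, A)` in a union bound (`design_near_union_le`). Hence with
probability tending to one `#A ≤ θ O(p / M)`, a vanishing fraction of `k ≈ ε p` as `M → ∞`. Note
that no restricted isometry is available: `#(S ∪ T)` may exceed `n`.
-/

namespace L0Selection

/-! ### Small-ball estimates for Gaussian vectors -/

theorem gaussianReal_integral_exp_neg_mul_sq {θ : ℝ} (hθ : 0 < θ) :
    ∫ x, Real.exp (-θ * x ^ 2) ∂(gaussianReal 0 1) = (√(1 + 2 * θ))⁻¹ := by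
  rw [integral_gaussianReal_eq_integral_smul one_ne_zero]
  have h : ∀ x : ℝ, gaussianPDFReal 0 1 x • Real.exp (-θ * x ^ 2)
      = (√(2 * Real.pi))⁻¹ * Real.exp (-(θ + 1 / 2) * x ^ 2) := by
    intro x
    simp only [gaussianPDFReal_def, NNReal.coe_one, mul_one, sub_zero, smul_eq_mul]
    rw [mul_assoc, ← Real.exp_add]
    congr 2
    ring
  simp_rw [h]
  rw [integral_const_mul, integral_gaussian, ← Real.sqrt_inv, ← Real.sqrt_inv, ← Real.sqrt_mul]
  · congr 1
    field_simp
    ring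
  · positivity

section SmallBall

variable {E : Type*} [NormedAddCommGroup E] [InnerProductSpace ℝ E] [FiniteDimensional ℝ E]
  [MeasurableSpace E] [BorelSpace E]

theorem stdGaussian_integral_exp_neg_mul_sq_norm {θ : ℝ} (hθ : 0 < θ) :
    ∫ x, Real.exp (-θ * ‖x‖ ^ 2) ∂(stdGaussian E)
      = (√(1 + 2 * θ))⁻¹ ^ Module.finrank ℝ E := by
  rw [stdGaussian, integral_map (Measurable.aemeasurable (by fun_prop))
    (Measurable.aestronglyMeasurable (by fun_prop))]
  have h : ∀ x : Fin (Module.finrank ℝ E) → ℝ,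
      Real.exp (-θ * ‖∑ i, x i • stdOrthonormalBasis ℝ E i‖ ^ 2)
        = ∏ i, Real.exp (-θ * x i ^ 2) := by
    intro x
    rw [← Real.exp_sum, ← Finset.mul_sum, ← (stdOrthonormalBasis ℝ E).sum_sq_inner_right]
    congr 2
    refine Finset.sum_congr rfl fun i _ => ?_
    congr 1
    simp [inner_sum, real_inner_smul_right, (stdOrthonormalBasis ℝ E).inner_eq_ite]
  simp_rw [h]
  rw [integral_fintype_prod_eq_pow (fun x : ℝ => Real.exp (-θ * x ^ 2)),
    gaussianReal_integral_exp_neg_mul_sq hθ, Fintype.card_fin]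

/-- Chernoff's bound for the lower tail of a chi-square variable. -/
theorem stdGaussian_norm_sq_le {θ : ℝ} (hθ : 0 < θ) (r : ℝ) :
    stdGaussian E {x | ‖x‖ ^ 2 ≤ r}
      ≤ ENNReal.ofReal (Real.exp (θ * r) * (√(1 + 2 * θ))⁻¹ ^ Module.finrank ℝ E) := by
  have hint : Integrable (fun x : E => Real.exp (-θ * ‖x‖ ^ 2)) (stdGaussian E) := by
    refine Integrable.of_bound (C := 1) (Measurable.aestronglyMeasurable (by fun_prop))
      (ae_of_all _ fun x => ?_)
    rw [Real.norm_eq_abs, Real.abs_exp]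
    exact Real.exp_le_one_iff.mpr (by nlinarith [sq_nonneg ‖x‖])
  have h := mul_meas_ge_le_integral_of_nonneg (μ := stdGaussian E)
    (ae_of_all _ fun x => (Real.exp_pos (-θ * ‖x‖ ^ 2)).le) hint (Real.exp (-θ * r))
  rw [stdGaussian_integral_exp_neg_mul_sq_norm hθ] at h
  have hset : {x : E | Real.exp (-θ * r) ≤ Real.exp (-θ * ‖x‖ ^ 2)} = {x | ‖x‖ ^ 2 ≤ r} := by
    ext x
    simp only [Set.mem_ofPred_eq, Real.exp_le_exp]
    constructor <;> intro h <;> nlinarith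
  rw [hset] at h
  refine (ENNReal.le_ofReal_iff_toReal_le (measure_ne_top _ _) (by positivity)).mpr ?_
  have h2 : Real.exp (θ * r) * Real.exp (-θ * r) = 1 := by
    rw [← Real.exp_add]; simp
  calc (stdGaussian E).real {x | ‖x‖ ^ 2 ≤ r}
      = Real.exp (θ * r) * (Real.exp (-θ * r) * (stdGaussian E).real {x | ‖x‖ ^ 2 ≤ r}) := by
        rw [← mul_assoc, h2, one_mul]
    _ ≤ _ := by gcongr

theorem stdGaussian_map_orthogonalProjection (K : Submodule ℝ E) :
    (stdGaussian E).map K.orthogonalProjectionOnto = stdGaussian K := by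
  apply Measure.ext_of_charFun
  ext t
  rw [charFun_stdGaussian, charFun_apply, integral_map (Measurable.aemeasurable (by fun_prop))
    (Measurable.aestronglyMeasurable (by fun_prop))]
  simp only [Submodule.inner_orthogonalProjectionOnto_eq_of_mem_right]
  rw [← charFun_apply, charFun_stdGaussian]
  rfl

/-- A standard Gaussian vector is unlikely to be close to a subspace `U`: its distance to `U` is at
least the norm of its projection onto `Uᗮ`, which is again a standard Gaussian vector. -/
theorem stdGaussian_near_submodule_le {θ : ℝ} (hθ : 0 < θ) (U : Submodule ℝ E) (r : ℝ) :
    stdGaussian E {x | ∃ u ∈ U, ‖x - u‖ ^ 2 < r}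
      ≤ ENNReal.ofReal (Real.exp (θ * r) * (√(1 + 2 * θ))⁻¹ ^ Module.finrank ℝ Uᗮ) := by
  refine le_trans ?_ (stdGaussian_norm_sq_le (E := Uᗮ) hθ r)
  rw [← stdGaussian_map_orthogonalProjection, Measure.map_apply (by fun_prop)
    (measurableSet_le (by fun_prop) (by fun_prop))]
  refine measure_mono ?_
  rintro x ⟨u, hu, hx⟩
  have h : Uᗮ.orthogonalProjectionOnto x = Uᗮ.orthogonalProjectionOnto (x - u) := by
    rw [map_sub, Submodule.orthogonalProjectionOnto_orthogonal_apply_eq_zero hu, sub_zero]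
  have h2 := Uᗮ.norm_orthogonalProjectionOnto_apply_le (x - u)
  simp only [Set.mem_preimage, Set.mem_ofPred_eq, h]
  refine le_trans ?_ hx.le
  gcongr

end SmallBall

/-- The small-ball estimate for the column space of a fixed matrix `W`, with the Chernoff parameter
chosen so that each of the `n - card ι` directions orthogonal to the columns gains a factor
`exp (-L)`. -/
theorem pi_gaussianReal_near_range_le {n : ℕ} {ι : Type*} [Fintype ι] {v : ℝ≥0} (hv : v ≠ 0)
    {L : ℝ} (hL : 0 < L) (W : Fin n → ι → ℝ) :
    (Measure.pi fun _ : Fin n => gaussianReal 0 v)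
        {g | ∃ b : ι → ℝ, ∑ i, (g i - ∑ j, W i j * b j) ^ 2
          < v * (n / ((Real.exp (2 * L) - 1) / 2))}
      ≤ ENNReal.ofReal (Real.exp (n - L * (n - Fintype.card ι))) := by
  set θ : ℝ := (Real.exp (2 * L) - 1) / 2 with hθdef
  have hθ : 0 < θ := by
    have := Real.add_one_lt_exp (x := 2 * L) (by positivity)
    rw [hθdef]; linarith
  have hsqrt : √(1 + 2 * θ) = Real.exp L := by
    rw [hθdef, show 1 + 2 * ((Real.exp (2 * L) - 1) / 2) = Real.exp L ^ 2 by
      rw [← Real.exp_nat_mul]; push_cast; ring]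
    exact Real.sqrt_sq (Real.exp_pos _).le
  let f : (ι → ℝ) →ₗ[ℝ] EuclideanSpace ℝ (Fin n) :=
    (WithLp.linearEquiv 2 ℝ (Fin n → ℝ)).symm.toLinearMap ∘ₗ (Matrix.of W).mulVecLin
  have hf : ∀ b i, f b i = ∑ j, W i j * b j := fun b i => rfl
  let U := LinearMap.range f
  have hU : Module.finrank ℝ U ≤ Fintype.card ι := by
    refine (LinearMap.finrank_range_le f).trans ?_
    simp
  have hadd := U.finrank_add_finrank_orthogonal
  rw [finrank_euclideanSpace, Fintype.card_fin] at hadd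
  have hlaw : (Measure.pi fun _ : Fin n => gaussianReal 0 v)
      = (Measure.pi fun _ : Fin n => gaussianReal 0 1).map (fun x i => √v * x i) := by
    rw [Measure.pi_map_pi (fun i => by fun_prop)]
    congr 1
    ext1 i
    rw [gaussianReal_map_const_mul]
    congr 1
    · simp
    · ext; simp
  have hb := stdGaussian_near_submodule_le hθ U ((n : ℝ) / θ)
  rw [← map_pi_eq_stdGaussian] at hb
  have hmeas : MeasurableSet
      {x : EuclideanSpace ℝ (Fin n) | ∃ u ∈ U, ‖x - u‖ ^ 2 < (n : ℝ) / θ} := by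
    refine IsOpen.measurableSet ?_
    have : {x : EuclideanSpace ℝ (Fin n) | ∃ u ∈ U, ‖x - u‖ ^ 2 < (n : ℝ) / θ}
        = ⋃ u ∈ U, {x | ‖x - u‖ ^ 2 < (n : ℝ) / θ} := by ext; simp
    rw [this]
    exact isOpen_biUnion fun u _ => isOpen_lt (by fun_prop) (by fun_prop)
  have hmeas2 : MeasurableSet {g : Fin n → ℝ | ∃ b : ι → ℝ,
      ∑ i, (g i - ∑ j, W i j * b j) ^ 2 < v * ((n : ℝ) / θ)} := by
    refine IsOpen.measurableSet ?_
    simp only [Set.ofPred_exists]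
    exact isOpen_iUnion fun u => isOpen_lt (by fun_prop) (by fun_prop)
  rw [Measure.map_apply (by fun_prop) hmeas] at hb
  rw [hlaw, Measure.map_apply (by fun_prop) hmeas2]
  refine (measure_mono ?_).trans (hb.trans (ENNReal.ofReal_le_ofReal ?_))
  · rintro x ⟨b, hb⟩
    have hv0 : (0 : ℝ) < v := by positivity
    refine ⟨f ((√v)⁻¹ • b), ⟨_, rfl⟩, ?_⟩
    rw [EuclideanSpace.real_norm_sq_eq]
    refine lt_of_mul_lt_mul_left (lt_of_eq_of_lt ?_ hb) hv0.le
    rw [Finset.mul_sum]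
    refine Finset.sum_congr rfl fun i _ => ?_
    rw [map_smul]
    have hs : √(v : ℝ) ≠ 0 := by positivity
    nth_rewrite 1 [← Real.sq_sqrt hv0.le]
    rw [← mul_pow]
    congr 1
    simp only [PiLp.sub_apply, PiLp.smul_apply, smul_eq_mul, hf]
    field_simp
  · rw [hsqrt, ← Real.exp_neg, ← Real.exp_nat_mul, ← Real.exp_add, Real.exp_le_exp,
      mul_div_cancel₀ _ hθ.ne']
    have h1 : (Module.finrank ℝ U : ℝ) ≤ Fintype.card ι := by exact_mod_cast hU
    have h2 : (Module.finrank ℝ U : ℝ) + Module.finrank ℝ Uᗮ = n := by exact_mod_cast hadd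
    nlinarith

/-! ### Separation of column sums from column spaces of the design -/

theorem pi_gaussianReal_map_sum {ι : Type*} [Fintype ι] (v : ℝ≥0) (A : Finset ι) :
    (Measure.pi fun _ : ι => gaussianReal 0 v).map (fun x => ∑ j ∈ A, x j)
      = gaussianReal 0 (A.card * v) := by
  classical
  induction A using Finset.induction_on with
  | empty => simp [gaussianReal_zero_var]
  | insert a A ha ih =>
    have hind : iIndepFun (fun (i : ι) (x : ι → ℝ) => x i)
        (Measure.pi fun _ : ι => gaussianReal 0 v) :=
      iIndepFun_pi (X := fun _ x => x) fun _ => by fun_prop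
    have h1 := (hind.indepFun_finsetSum_of_notMem (fun i => by fun_prop) ha).symm
    have h2 := gaussianReal_add_gaussianReal_of_indepFun (m₁ := 0) (v₁ := v) (m₂ := 0)
      (v₂ := A.card * v) h1 (measurePreserving_eval _ a).map_eq
      (by simpa [Finset.sum_fn] using ih)
    have h3 : (fun x : ι → ℝ => ∑ j ∈ insert a A, x j)
        = (fun x => x a) + ∑ j ∈ A, fun x : ι → ℝ => x j := by
      ext x; simp [Finset.sum_insert ha]
    rw [h3, h2, Finset.card_insert_of_notMem ha]
    congr 1
    · simp
    · push_cast; ring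

/-- Within a row of the design, the entries in `S` are independent of the sum of the entries in a
disjoint set `A`. -/
theorem measurePreserving_restrict_sum {ι : Type*} [Fintype ι] (v : ℝ≥0) {S A : Finset ι}
    (hSA : Disjoint S A) :
    MeasurePreserving (fun x : ι → ℝ => ((fun j : S => x j), ∑ j ∈ A, x j))
      (Measure.pi fun _ : ι => gaussianReal 0 v)
      (((Measure.pi fun _ : ι => gaussianReal 0 v).map fun x (j : S) => x j).prod
        (gaussianReal 0 (A.card * v))) := by
  refine ⟨by fun_prop, ?_⟩
  have hind : iIndepFun (fun (i : ι) (x : ι → ℝ) => x i)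
      (Measure.pi fun _ : ι => gaussianReal 0 v) :=
    iIndepFun_pi (X := fun _ x => x) fun _ => by fun_prop
  have h1 := hind.indepFun_finset S A hSA (fun i => by fun_prop)
  have h2 := h1.comp (φ := id) (ψ := fun y : A → ℝ => ∑ j, y j) measurable_id (by fun_prop)
  have hm : Measurable fun (x : ι → ℝ) (j : S) => x j := by fun_prop
  have h3 := (indepFun_iff_map_prod_eq_prod_map_map (measurable_id.comp hm).aemeasurable
    (Measurable.aemeasurable (by fun_prop))).mp h2
  have h4 : ((fun y : A → ℝ => ∑ j, y j) ∘ fun (x : ι → ℝ) (j : A) => x j)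
      = fun x => ∑ j ∈ A, x j := by
    ext x
    exact Finset.sum_coe_sort A x
  rw [h4, pi_gaussianReal_map_sum, Function.id_comp] at h3
  exact h3

/-- For fixed disjoint `S` and `A`, the sum of the columns in `A` is unlikely to be close to the
span of the columns in `S`, relative to its own size `#A`. -/
theorem design_near_le {n p : ℕ} (hn : 0 < n) {L : ℝ} (hL : 0 < L) {S A : Finset (Fin p)}
    (hSA : Disjoint S A) :
    (Measure.pi fun _ : Fin n => Measure.pi fun _ : Fin p => gaussianReal 0 (1 / (n : ℝ≥0)))
        {X | ∃ c : Fin p → ℝ, (∀ j, j ∉ S → c j = 0) ∧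
          ∑ i, (∑ j ∈ A, X i j - ∑ j, X i j * c j) ^ 2 < A.card / ((Real.exp (2 * L) - 1) / 2)}
      ≤ ENNReal.ofReal (Real.exp (n - L * (n - S.card))) := by
  have hθ : 0 < (Real.exp (2 * L) - 1) / 2 := by
    have := Real.add_one_lt_exp (x := 2 * L) (by positivity)
    linarith
  set θ := (Real.exp (2 * L) - 1) / 2 with hθdef
  have hn' : (n : ℝ) ≠ 0 := by positivity
  -- For `A = ∅` the column sum has variance zero, but the strict inequality makes the event empty.
  rcases A.eq_empty_or_nonempty with rfl | hA
  · refine (measure_mono_null (t := ∅) ?_ measure_empty).le.trans bot_le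
    rintro X ⟨c, -, h⟩
    simp only [Finset.card_empty, Nat.cast_zero, zero_div] at h
    exact absurd h (not_lt.mpr (Finset.sum_nonneg fun i _ => sq_nonneg _))
  set v : ℝ≥0 := A.card * (1 / (n : ℝ≥0)) with hv
  have hv0 : v ≠ 0 := by
    rw [hv]
    have := hA.card_pos
    positivity
  have hvr : (v : ℝ) * (n / θ) = A.card / θ := by
    rw [hv]; push_cast; field_simp
  set ν : Measure (S → ℝ) :=
    (Measure.pi fun _ : Fin p => gaussianReal 0 (1 / (n : ℝ≥0))).map fun x (j : S) => x j with hν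
  have : IsProbabilityMeasure ν := 
    Measure.isProbabilityMeasure_map (Measurable.aemeasurable (by fun_prop))
  have hmp := (measurePreserving_arrowProdEquivProdArrow (S → ℝ) ℝ (Fin n) (fun _ => ν)
    (fun _ => gaussianReal 0 v)).comp (measurePreserving_pi _ _ fun _ : Fin n =>
      measurePreserving_restrict_sum (1 / (n : ℝ≥0)) hSA)
  -- Thanks to the strict inequality the event is a union of open sets, hence measurable.
  let F : Set ((Fin n → S → ℝ) × (Fin n → ℝ)) :=
    {q | ∃ b : S → ℝ, ∑ i, (q.2 i - ∑ j, q.1 i j * b j) ^ 2 < A.card / θ}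
  have hF : MeasurableSet F := by
    refine IsOpen.measurableSet ?_
    simp only [F, Set.ofPred_exists]
    exact isOpen_iUnion fun u => isOpen_lt (by fun_prop) (by fun_prop)
  have hpre := hmp.measure_preimage hF.nullMeasurableSet
  refine (measure_mono ?_).trans (hpre.le.trans ?_)
  · rintro X ⟨c, hc, h⟩
    refine ⟨fun j => c j, lt_of_eq_of_lt ?_ h⟩
    refine Finset.sum_congr rfl fun i _ => ?_
    congr 2
    change ∑ j : S, X i j * c j = _
    rw [Finset.sum_coe_sort S fun j => X i j * c j]
    exact Finset.sum_subset (Finset.subset_univ _) fun j _ hj => by rw [hc j hj, mul_zero]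
  · rw [Measure.prod_apply hF]
    refine (lintegral_mono fun W => ?_).trans (by rw [lintegral_const, measure_univ, mul_one])
    have h := pi_gaussianReal_near_range_le hv0 hL W
    rw [← hθdef, hvr, Fintype.card_coe] at h
    exact h

/-- The union bound over the at most `4 ^ p` pairs `(S, A)`. No reference to `β` is made, so that
the sets may later depend on all of the data. -/
theorem design_near_union_le {n p : ℕ} (hn : 0 < n) {L : ℝ} (hL : 0 < L) (s : ℝ) :
    (Measure.pi fun _ : Fin n => Measure.pi fun _ : Fin p => gaussianReal 0 (1 / (n : ℝ≥0)))
        {X | ∃ S A : Finset (Fin p), Disjoint S A ∧ (S.card : ℝ) ≤ s ∧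
          ∃ c : Fin p → ℝ, (∀ j, j ∉ S → c j = 0) ∧
          ∑ i, (∑ j ∈ A, X i j - ∑ j, X i j * c j) ^ 2 < A.card / ((Real.exp (2 * L) - 1) / 2)}
      ≤ ENNReal.ofReal (4 ^ p * Real.exp (n - L * (n - s))) := by
  classical
  have hsub : {X : Fin n → Fin p → ℝ | ∃ S A : Finset (Fin p), Disjoint S A ∧ (S.card : ℝ) ≤ s ∧
        ∃ c : Fin p → ℝ, (∀ j, j ∉ S → c j = 0) ∧
        ∑ i, (∑ j ∈ A, X i j - ∑ j, X i j * c j) ^ 2 < A.card / ((Real.exp (2 * L) - 1) / 2)}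
      ⊆ ⋃ q ∈ (Finset.univ : Finset (Finset (Fin p) × Finset (Fin p))),
        {X | (Disjoint q.1 q.2 ∧ (q.1.card : ℝ) ≤ s) ∧ ∃ c : Fin p → ℝ, (∀ j, j ∉ q.1 → c j = 0) ∧
        ∑ i, (∑ j ∈ q.2, X i j - ∑ j, X i j * c j) ^ 2
          < q.2.card / ((Real.exp (2 * L) - 1) / 2)} := by
    rintro X ⟨S, A, h1, h2, h3⟩
    exact Set.mem_biUnion (Finset.mem_univ (S, A)) ⟨⟨h1, h2⟩, h3⟩
  refine (measure_mono hsub).trans ((measure_biUnion_finset_le _ _).trans ?_)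
  refine (Finset.sum_le_card_nsmul _ _ (ENNReal.ofReal (Real.exp (n - L * (n - s)))) ?_).trans ?_
  · rintro ⟨S, A⟩ -
    by_cases h : Disjoint S A ∧ (S.card : ℝ) ≤ s
    · simp only [h, true_and]
      refine (design_near_le hn hL h.1).trans (ENNReal.ofReal_le_ofReal ?_)
      have := h.2
      gcongr
    · simp [h]
  · rw [nsmul_eq_mul, ENNReal.ofReal_mul (by positivity)]
    gcongr
    rw [Finset.card_univ, Fintype.card_prod, Fintype.card_finset, Fintype.card_fin, ← mul_pow,
      ENNReal.ofReal_pow (by norm_num)]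
    norm_num

/-! ### Concentration of the number of signals and of the noise -/

/-- Chebyshev's inequality for sums of i.i.d. random variables. -/
theorem pi_sum_deviation_le {n : ℕ} (μ : Measure ℝ) [IsProbabilityMeasure μ] {f : ℝ → ℝ}
    (hf : MemLp f 2 μ) (hn : 0 < n) {a : ℝ} (ha : 0 < a) :
    (Measure.pi fun _ : Fin n => μ) {x | a * n ≤ |∑ i, f (x i) - n * ∫ t, f t ∂μ|}
      ≤ ENNReal.ofReal (variance f μ / a ^ 2 / n) := by
  have hL : MemLp (∑ i : Fin n, fun x : Fin n → ℝ => f (x i)) 2 (Measure.pi fun _ : Fin n => μ) :=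
    memLp_finsetSum' _ fun i _ => hf.comp_measurePreserving (measurePreserving_eval _ i)
  have hn' : (0 : ℝ) < n := by exact_mod_cast hn
  have h := meas_ge_le_variance_div_sq hL (c := a * n) (by positivity)
  rw [variance_sum_pi fun _ => hf] at h
  have hmean : ∫ x, (∑ i : Fin n, fun x : Fin n → ℝ => f (x i)) x ∂(Measure.pi fun _ : Fin n => μ)
      = n * ∫ t, f t ∂μ := by
    simp only [Finset.sum_apply]
    rw [integral_finsetSum]
    · simp [integral_comp_eval (μ := fun _ : Fin n => μ) hf.aestronglyMeasurable]
    · exact fun i _ => integrable_comp_eval (hf.integrable one_le_two)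
  rw [hmean] at h
  simp only [Finset.sum_apply, Finset.sum_const, Finset.card_univ, Fintype.card_fin,
    nsmul_eq_mul] at h
  refine h.trans (ENNReal.ofReal_le_ofReal (le_of_eq ?_))
  field_simp

theorem isProbabilityMeasure_twoPointPrior {ε : ℝ} (hε0 : 0 ≤ ε) (hε1 : ε ≤ 1) (M : ℝ) :
    IsProbabilityMeasure (twoPointPrior ε M) := by
  refine ⟨?_⟩
  simp only [twoPointPrior, Measure.add_apply, Measure.smul_apply, measure_univ]
  rw [ENNReal.smul_def, ENNReal.smul_def, smul_eq_mul, smul_eq_mul, mul_one, mul_one,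
    ← ENNReal.coe_add, ← Real.toNNReal_add hε0 (by linarith)]
  simp

theorem integral_indicator_twoPointPrior {ε M : ℝ} (hε0 : 0 ≤ ε) (hM : M ≠ 0) :
    ∫ t, (if t ≠ 0 then (1 : ℝ) else 0) ∂(twoPointPrior ε M) = ε := by
  rw [twoPointPrior, integral_add_measure, integral_smul_nnreal_measure,
    integral_smul_nnreal_measure, integral_dirac, integral_dirac]
  · simp [hM, NNReal.smul_def, hε0]
  · exact (integrable_dirac (by simp)).smul_measure_nnreal
  · exact (integrable_dirac (by simp)).smul_measure_nnreal

theorem memLp_ne_zero_indicator (μ : Measure ℝ) [IsProbabilityMeasure μ] :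
    MemLp (fun t : ℝ => if t ≠ 0 then (1 : ℝ) else 0) 2 μ := by
  refine MemLp.of_bound (C := 1) (Measurable.aestronglyMeasurable ?_) (ae_of_all _ fun x => ?_)
  · exact Measurable.ite (measurableSet_singleton (0 : ℝ)).compl measurable_const measurable_const
  · split_ifs <;> simp

theorem ae_twoPointPrior (ε M : ℝ) : ∀ᵐ t ∂(twoPointPrior ε M), t = M ∨ t = 0 := by
  rw [twoPointPrior, ae_add_measure_iff]
  constructor
  · exact Measure.ae_smul_measure (by simp [ae_dirac_eq]) _
  · exact Measure.ae_smul_measure (by simp [ae_dirac_eq]) _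

theorem pi_twoPointPrior_ae {ε : ℝ} (hε0 : 0 ≤ ε) (hε1 : ε ≤ 1) (M : ℝ) (p : ℕ) :
    ∀ᵐ β ∂(Measure.pi fun _ : Fin p => twoPointPrior ε M), ∀ j, β j = M ∨ β j = 0 := by
  have := isProbabilityMeasure_twoPointPrior hε0 hε1 M
  rw [ae_all_iff]
  exact fun j => (Measure.quasiMeasurePreserving_eval (fun _ => twoPointPrior ε M) j).ae
    (p := fun t => t = M ∨ t = 0) (ae_twoPointPrior ε M)

theorem l0norm_concentration {ε : ℝ} (hε0 : 0 ≤ ε) (hε1 : ε ≤ 1) {M : ℝ} (hM : M ≠ 0) {p : ℕ}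
    (hp : 0 < p) {a : ℝ} (ha : 0 < a) :
    (Measure.pi fun _ : Fin p => twoPointPrior ε M) {β | a * p ≤ |(l0norm β : ℝ) - ε * p|}
      ≤ ENNReal.ofReal
        (variance (fun t : ℝ => if t ≠ 0 then (1 : ℝ) else 0) (twoPointPrior ε M) / a ^ 2 / p) := by
  have := isProbabilityMeasure_twoPointPrior hε0 hε1 M
  have h := pi_sum_deviation_le (twoPointPrior ε M) (memLp_ne_zero_indicator _) hp ha
  rw [integral_indicator_twoPointPrior hε0 hM] at h
  have hcount : ∀ β : Fin p → ℝ, (l0norm β : ℝ) = ∑ j, if β j ≠ 0 then (1 : ℝ) else 0 := by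
    intro β
    rw [Finset.sum_boole, l0norm]
  simp only [hcount, mul_comm ε]
  exact h

theorem noise_concentration (σ : ℝ≥0) {n : ℕ} (hn : 0 < n) :
    (Measure.pi fun _ : Fin n => gaussianReal 0 (σ ^ 2)) {z | (σ ^ 2 + 1) * n ≤ ∑ i, z i ^ 2}
      ≤ ENNReal.ofReal (variance (fun t : ℝ => t ^ 2) (gaussianReal 0 (σ ^ 2)) / n) := by
  have hL : MemLp (fun t : ℝ => t ^ 2) 2 (gaussianReal 0 (σ ^ 2)) := by
    rw [memLp_two_iff_integrable_sq (by fun_prop)]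
    have := (memLp_id_gaussianReal (μ := 0) (v := σ ^ 2) 4).integrable_norm_pow (by norm_num)
    refine this.congr (ae_of_all _ fun x => ?_)
    simp only [id, Real.norm_eq_abs]
    rw [← pow_mul]
    exact Even.pow_abs (by decide) x
  have hmean : ∫ t, t ^ 2 ∂(gaussianReal 0 (σ ^ 2)) = (σ : ℝ) ^ 2 := by
    have := variance_fun_id_gaussianReal (μ := 0) (v := σ ^ 2)
    rw [variance_eq_integral (by fun_prop)] at this
    simpa using this
  have h := pi_sum_deviation_le _ hL hn one_pos
  rw [hmean] at h
  rw [one_pow, div_one] at h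
  refine (measure_mono fun z hz => ?_).trans h
  have hz' : ((σ : ℝ) ^ 2 + 1) * n ≤ ∑ i, z i ^ 2 := hz
  have hle : 1 * (n : ℝ) ≤ ∑ i, z i ^ 2 - n * (σ : ℝ) ^ 2 := by linarith
  exact hle.trans (le_abs_self _)

/-! ### Deterministic consequences of minimality -/

theorem falseDiscoveries_add_trueDiscoveries {p : ℕ} (β b : Fin p → ℝ) :
    falseDiscoveries β b + trueDiscoveries β b = l0norm b := by
  rw [falseDiscoveries, trueDiscoveries, l0norm,
    ← Finset.card_filter_add_card_filter_not (s := Finset.univ.filter fun j => b j ≠ 0)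
      (p := fun j => β j = 0), Finset.filter_filter, Finset.filter_filter]

/-- The missed signals: coordinates outside the support of `b` but in that of `β`. -/
noncomputable def missedCoords {p : ℕ} (β b : Fin p → ℝ) : Finset (Fin p) :=
  Finset.univ.filter fun j => b j = 0 ∧ β j ≠ 0

theorem trueDiscoveries_add_card_missedCoords {p : ℕ} (β b : Fin p → ℝ) :
    trueDiscoveries β b + (missedCoords β b).card = l0norm β := by
  rw [trueDiscoveries, missedCoords, l0norm,
    ← Finset.card_filter_add_card_filter_not (s := Finset.univ.filter fun j => β j ≠ 0)
      (p := fun j => b j ≠ 0), Finset.filter_filter, Finset.filter_filter]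
  simp only [and_comm, not_not]

theorem l0Argmin_basic_inequality {n p : ℕ} {lam : ℝ} {X : Matrix (Fin n) (Fin p) ℝ}
    {β b : Fin p → ℝ} {z : Fin n → ℝ} (hb : b ∈ l0Argmin lam X (X.mulVec β + z)) :
    ∑ i, ((X.mulVec β + z) i - X.mulVec b i) ^ 2 + lam * l0norm b
      ≤ ∑ i, z i ^ 2 + lam * l0norm β := by
  simpa [l0Objective] using hb β

/-- The columns missed by a minimizer have a sum close to the span of the selected columns. -/
theorem l0Argmin_missed_near {n p : ℕ} {M : ℝ} (hM : 0 < M) {X : Matrix (Fin n) (Fin p) ℝ}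
    {β b : Fin p → ℝ} {z : Fin n → ℝ} (hβ : ∀ j, β j = M ∨ β j = 0)
    (hb : b ∈ l0Argmin M X (X.mulVec β + z)) :
    ∃ c : Fin p → ℝ, (∀ j, b j = 0 → c j = 0) ∧
      ∑ i, (∑ j ∈ missedCoords β b, X i j - ∑ j, X i j * c j) ^ 2
        ≤ (4 * ∑ i, z i ^ 2 + 2 * M * l0norm β) / M ^ 2 := by
  -- `v = (b - β) / M` on the support of `b`: division by `M` turns the missed
  -- coefficients into ones.
  refine ⟨fun j => if b j = 0 then 0 else (b j - β j) / M, fun j hj => by simp [hj], ?_⟩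
  have hbasic := l0Argmin_basic_inequality hb
  have hpen : 0 ≤ M * (l0norm b : ℝ) := by positivity
  have hrow : ∀ i, M * (∑ j ∈ missedCoords β b, X i j
      - ∑ j, X i j * (if b j = 0 then 0 else (b j - β j) / M))
      = ((X.mulVec β + z) i - X.mulVec b i) - z i := by
    intro i
    rw [Pi.add_apply, add_sub_right_comm, add_sub_cancel_right, Matrix.mulVec, Matrix.mulVec,
      dotProduct, dotProduct, missedCoords, Finset.sum_filter, ← Finset.sum_sub_distrib,
      ← Finset.sum_sub_distrib, Finset.mul_sum]
    refine Finset.sum_congr rfl fun j _ => ?_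
    by_cases hbj : b j = 0
    · rcases hβ j with h | h
      · simp [hbj, h, hM.ne', mul_comm]
      · simp [hbj, h]
    · simp only [hbj, false_and, if_false]
      field_simp
      ring
  rw [le_div_iff₀ (by positivity), Finset.sum_mul]
  calc _ = ∑ i, (((X.mulVec β + z) i - X.mulVec b i) - z i) ^ 2 := by
        refine Finset.sum_congr rfl fun i _ => ?_
        rw [← hrow]; ring
    _ ≤ ∑ i, (2 * ((X.mulVec β + z) i - X.mulVec b i) ^ 2 + 2 * z i ^ 2) := by
        refine Finset.sum_le_sum fun i _ => ?_
        nlinarith [sq_nonneg (((X.mulVec β + z) i - X.mulVec b i) + z i)]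
    _ ≤ _ := by
        rw [Finset.sum_add_distrib, ← Finset.mul_sum, ← Finset.mul_sum]
        linarith

/-- Both error proportions are small once there are at least `ε p / 2` signals, few of them are
missed, and the number of selected coordinates does not exceed that of the signals by much. -/
theorem FDP_TPP_lt_of_counts {p : ℕ} {β b : Fin p → ℝ} {ε η : ℝ} (hε : 0 < ε) (hη : 0 < η)
    (hη1 : η ≤ 1) (hp : 0 < p) (hk : ε * p / 2 ≤ l0norm β)
    (hS : (l0norm b : ℝ) ≤ l0norm β + ε * η / 16 * p)
    (hA : ((missedCoords β b).card : ℝ) ≤ ε * η / 16 * p) :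
    |FDP β b - 0| < η ∧ |TPP β b - 1| < η := by
  have h1 : (falseDiscoveries β b : ℝ) + trueDiscoveries β b = l0norm b := by
    exact_mod_cast falseDiscoveries_add_trueDiscoveries β b
  have h2 : (trueDiscoveries β b : ℝ) + (missedCoords β b).card = l0norm β := by
    exact_mod_cast trueDiscoveries_add_card_missedCoords β b
  have hp' : (0 : ℝ) < p := by exact_mod_cast hp
  have hεp : 0 < ε * p := by positivity
  have hεηp : ε * η / 16 * p ≤ ε * p / 16 := by nlinarith
  have hεηp0 : 0 < ε * p * η := by positivity
  have hV0 : (0 : ℝ) ≤ falseDiscoveries β b := by positivity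
  have hk0 : (0 : ℝ) < l0norm β := by linarith
  have hk1 : (1 : ℝ) ≤ l0norm β := by
    have : 0 < l0norm β := by exact_mod_cast hk0
    exact_mod_cast this
  constructor
  · rw [sub_zero, FDP, abs_of_nonneg (by positivity), div_lt_iff₀ (by positivity)]
    have : (l0norm b : ℝ) ≤ max (l0norm b : ℝ) 1 := le_max_left _ _
    have h3 : ε * p / 4 ≤ max (l0norm b : ℝ) 1 := by linarith
    nlinarith
  · rw [TPP, max_eq_left hk1, div_sub_one hk0.ne', abs_div, abs_of_pos hk0, div_lt_iff₀ hk0,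
      abs_lt]
    constructor <;> nlinarith [(Nat.cast_nonneg (missedCoords β b).card : (0 : ℝ) ≤ _)]

/-- The deterministic core: small error proportions for every minimizer, on the event where the
number of signals and the noise are typical and column sums are separated from column spaces. -/
theorem FDP_TPP_lt_of_regular {n p : ℕ} (hp : 0 < p) {ε a c Cz θ M η : ℝ} (hε : 0 < ε)
    (hη : 0 < η) (hη1 : η ≤ 1) (hθ : 0 < θ) (hM : 0 < M) (hac : a ≤ c)
    (haε : a ≤ ε / 2) (hM1 : Cz / M ≤ c) (hM2 : Cz / M ≤ ε * η / 16)
    (hM3 : θ * (4 * Cz / M ^ 2 + 2 * (ε + c) / M) ≤ ε * η / 16)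
    {β : Fin p → ℝ} {X : Fin n → Fin p → ℝ} {z : Fin n → ℝ}
    (hβ : ∀ j, β j = M ∨ β j = 0) (hk : |(l0norm β : ℝ) - ε * p| < a * p)
    (hz : ∑ i, z i ^ 2 ≤ Cz * p)
    (hX : ∀ S A : Finset (Fin p), Disjoint S A → (S.card : ℝ) ≤ (ε + 2 * c) * p →
      ∀ v : Fin p → ℝ, (∀ j, j ∉ S → v j = 0) →
        A.card / θ ≤ ∑ i, (∑ j ∈ A, X i j - ∑ j, X i j * v j) ^ 2)
    {b : Fin p → ℝ} (hb : b ∈ l0Argmin M (Matrix.of X) ((Matrix.of X).mulVec β + z)) :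
    |FDP β b - 0| < η ∧ |TPP β b - 1| < η := by
  have hp' : (0 : ℝ) < p := by exact_mod_cast hp
  rw [abs_lt] at hk
  have hbasic := l0Argmin_basic_inequality hb
  have hres : 0 ≤ ∑ i, (((Matrix.of X).mulVec β + z) i - (Matrix.of X).mulVec b i) ^ 2 :=
    Finset.sum_nonneg fun i _ => sq_nonneg _
  have hS : (l0norm b : ℝ) ≤ l0norm β + Cz / M * p := by
    have h : M * (l0norm b : ℝ) ≤ M * (l0norm β + Cz / M * p) := by
      have : M * (Cz / M * p) = Cz * p := by field_simp
      linarith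
    exact le_of_mul_le_mul_left h hM
  obtain ⟨v, hv0, hv⟩ := l0Argmin_missed_near hM hβ hb
  have hap : a * p ≤ c * p := by gcongr
  have hap2 : a * p ≤ ε / 2 * p := by gcongr
  have hcp : Cz / M * p ≤ c * p := by gcongr
  have hcp2 : Cz / M * p ≤ ε * η / 16 * p := by gcongr
  have hsep := hX (Finset.univ.filter fun j => b j ≠ 0) (missedCoords β b)
    (by
      rw [Finset.disjoint_left]
      intro j hj hj'
      simp only [missedCoords, Finset.mem_filter, Finset.mem_univ, true_and] at hj hj'
      exact hj hj'.1)
    (by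
      change (l0norm b : ℝ) ≤ _
      linarith) v (by simpa using hv0)
  refine FDP_TPP_lt_of_counts hε hη hη1 hp (by linarith) (by linarith) ?_
  have h1 := hsep.trans hv
  rw [div_le_iff₀ hθ] at h1
  refine h1.trans (le_trans ?_ (mul_le_mul_of_nonneg_right hM3 hp'.le))
  have hk2 : (l0norm β : ℝ) ≤ (ε + c) * p := by linarith
  calc (4 * ∑ i, z i ^ 2 + 2 * M * l0norm β) / M ^ 2 * θ
      ≤ (4 * (Cz * p) + 2 * M * ((ε + c) * p)) / M ^ 2 * θ := by gcongr
    _ = _ := by field_simp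

/-! ### Probability of the exceptional event -/

/-- The event on which some minimizer errs need not be measurable; its outer measure is bounded by
covering it with cylinders over exceptional events for `β`, `X` and `z` separately. -/
theorem modelLaw_exceptional_le {n p : ℕ} (hn : 0 < n) (hp : 0 < p) {ε δ a c L M η : ℝ}
    (σ : ℝ≥0) (hε : 0 < ε) (hε1 : ε ≤ 1) (hη : 0 < η) (hη1 : η ≤ 1) (hM : 0 < M)
    (ha : 0 < a) (hac : a ≤ c) (haε : a ≤ ε / 2) (hL : 0 < L) (hnp : (n : ℝ) ≤ 2 * δ * p)
    (hM1 : (σ ^ 2 + 1) * (2 * δ) / M ≤ c) (hM2 : (σ ^ 2 + 1) * (2 * δ) / M ≤ ε * η / 16)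
    (hM3 : (Real.exp (2 * L) - 1) / 2 *
      (4 * ((σ ^ 2 + 1) * (2 * δ)) / M ^ 2 + 2 * (ε + c) / M) ≤ ε * η / 16) :
    modelLaw n p σ (twoPointPrior ε M)
        {s | ∃ b ∈ l0Argmin M s.design s.response,
          ¬ (|FDP s.coef b - 0| < η ∧ |TPP s.coef b - 1| < η)}
      ≤ ENNReal.ofReal (variance (fun t : ℝ => if t ≠ 0 then (1 : ℝ) else 0)
          (twoPointPrior ε M) / a ^ 2 / p)
        + (ENNReal.ofReal (4 ^ p * Real.exp (n - L * (n - (ε + 2 * c) * p)))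
        + ENNReal.ofReal (variance (fun t : ℝ => t ^ 2) (gaussianReal 0 (σ ^ 2)) / n)) := by
  have hprob := isProbabilityMeasure_twoPointPrior hε.le hε1 M
  have hθ : 0 < (Real.exp (2 * L) - 1) / 2 := by
    have := Real.add_one_lt_exp (x := 2 * L) (by positivity)
    linarith
  set B₀ : Set (Fin p → ℝ) := {β | ∀ j, β j = M ∨ β j = 0}ᶜ
  set B₁ : Set (Fin p → ℝ) := {β | a * p ≤ |(l0norm β : ℝ) - ε * p|} with hB₁
  set B₂ : Set (Fin n → Fin p → ℝ) := {X | ∃ S A : Finset (Fin p), Disjoint S A ∧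
    (S.card : ℝ) ≤ (ε + 2 * c) * p ∧ ∃ v : Fin p → ℝ, (∀ j, j ∉ S → v j = 0) ∧
      ∑ i, (∑ j ∈ A, X i j - ∑ j, X i j * v j) ^ 2
        < A.card / ((Real.exp (2 * L) - 1) / 2)} with hB₂
  set B₃ : Set (Fin n → ℝ) := {z | (σ ^ 2 + 1) * n ≤ ∑ i, z i ^ 2} with hB₃
  have hsub : {s : Sample n p | ∃ b ∈ l0Argmin M s.design s.response,
      ¬ (|FDP s.coef b - 0| < η ∧ |TPP s.coef b - 1| < η)}
      ⊆ ((B₀ ∪ B₁) ×ˢ Set.univ) ∪ (Set.univ ×ˢ ((B₂ ×ˢ Set.univ) ∪ (Set.univ ×ˢ B₃))) := by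
    rintro ⟨β, X, z⟩ ⟨b, hb, hbad⟩
    by_contra hs
    simp only [Set.mem_union, Set.mem_prod, Set.mem_univ, and_true, true_and, not_or] at hs
    obtain ⟨⟨h0, h1⟩, h2, h3⟩ := hs
    refine hbad (FDP_TPP_lt_of_regular (X := X) (z := z) hp hε hη hη1 hθ hM hac haε hM1 hM2 hM3
      (not_not.mp h0) (not_le.mp h1) ?_ ?_ hb)
    · refine (not_le.mp h3).le.trans ?_
      calc ((σ : ℝ) ^ 2 + 1) * n ≤ (σ ^ 2 + 1) * (2 * δ * p) := by gcongr
        _ = _ := by ring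
    · intro S A hSA hS v hv
      by_contra hlt
      exact h2 ⟨S, A, hSA, hS, v, hv, not_le.mp hlt⟩
  refine (measure_mono hsub).trans ((measure_union_le _ _).trans (add_le_add ?_ ?_))
  · rw [modelLaw, Measure.prod_prod, measure_univ, mul_one]
    refine (measure_union_le _ _).trans ?_
    have h0 : (Measure.pi fun _ : Fin p => twoPointPrior ε M) B₀ = 0 :=
      pi_twoPointPrior_ae hε.le hε1 M p
    rw [h0, zero_add]
    exact l0norm_concentration hε.le hε1 hM.ne' hp ha
  · rw [modelLaw, Measure.prod_prod, measure_univ, one_mul]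
    refine (measure_union_le _ _).trans (add_le_add ?_ ?_)
    · rw [Measure.prod_prod, measure_univ, mul_one]
      exact design_near_union_le hn hL _
    · rw [Measure.prod_prod, measure_univ, one_mul]
      exact noise_concentration σ hn

theorem tendsto_ofReal_div_cast (C : ℝ) :
    Tendsto (fun n : ℕ => ENNReal.ofReal (C / n)) atTop (𝓝 0) := by
  simpa using ENNReal.tendsto_ofReal (tendsto_const_div_atTop_nhds_zero_nat C)

theorem modelLaw_exceptional_tendsto {δ ε : ℝ} (σ : ℝ≥0) (hε0 : 0 < ε) (hε1 : ε < 1)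
    (hεδ : ε < δ) {η : ℝ} (hη : 0 < η) (hη1 : η ≤ 1) :
    ∀ᶠ M : ℝ in atTop, Tendsto (fun q : ℕ × ℕ =>
      modelLaw q.1 q.2 σ (twoPointPrior ε M)
        {s | ∃ b ∈ l0Argmin M s.design s.response,
          ¬ (|FDP s.coef b - 0| < η ∧ |TPP s.coef b - 1| < η)})
      (proportionalLimit δ) (𝓝 0) := by
  -- A margin with `ε + 3 * c < δ`: eventually `#S ≤ (ε + 2 * c) * p` while `n ≥ (ε + 3 * c) * p`.
  set c : ℝ := (δ - ε) / 4 with hc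
  have hc0 : 0 < c := by rw [hc]; linarith
  set a : ℝ := min c (ε / 2) with ha
  have ha0 : 0 < a := lt_min hc0 (by linarith)
  -- The constant for which `4 ^ p * exp (2 * δ * p - L * c * p) = exp (-p)`.
  set L : ℝ := (Real.log 4 + 2 * δ + 1) / c with hLdef
  have hlog4 : 0 < Real.log 4 := Real.log_pos (by norm_num)
  have hL : 0 < L := div_pos (by linarith) hc0
  have hLc : L * c = Real.log 4 + 2 * δ + 1 := div_mul_cancel₀ _ hc0.ne'
  set Cz : ℝ := (σ ^ 2 + 1) * (2 * δ) with hCz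
  have hlim1 : Tendsto (fun M : ℝ => Cz / M) atTop (𝓝 0) := tendsto_const_nhds.div_atTop tendsto_id
  have hlim2 : Tendsto (fun M : ℝ => (Real.exp (2 * L) - 1) / 2 *
      (4 * Cz / M ^ 2 + 2 * (ε + c) / M)) atTop (𝓝 0) := by
    have h1 : Tendsto (fun M : ℝ => 4 * Cz / M ^ 2) atTop (𝓝 0) :=
      tendsto_const_nhds.div_atTop (tendsto_pow_atTop two_ne_zero)
    have h2 : Tendsto (fun M : ℝ => 2 * (ε + c) / M) atTop (𝓝 0) :=
      tendsto_const_nhds.div_atTop tendsto_id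
    simpa using (h1.add h2).const_mul ((Real.exp (2 * L) - 1) / 2)
  have hκ : 0 < ε * η / 16 := by positivity
  filter_upwards [eventually_gt_atTop 0, hlim1.eventually (eventually_le_nhds hc0),
    hlim1.eventually (eventually_le_nhds hκ), hlim2.eventually (eventually_le_nhds hκ)]
    with M hM hM1 hM2 hM3
  have hfst : Tendsto Prod.fst (proportionalLimit δ) atTop := tendsto_fst.mono_left inf_le_left
  have hsnd : Tendsto Prod.snd (proportionalLimit δ) atTop := tendsto_snd.mono_left inf_le_left
  have hratio : Tendsto (fun q : ℕ × ℕ => (q.1 : ℝ) / q.2) (proportionalLimit δ) (𝓝 δ) :=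
    tendsto_comap.mono_left inf_le_right
  have hbound := ((tendsto_ofReal_div_cast (variance (fun t : ℝ => if t ≠ 0 then (1 : ℝ) else 0)
    (twoPointPrior ε M) / a ^ 2)).comp hsnd).add
    (((ENNReal.tendsto_ofReal (Real.tendsto_exp_neg_atTop_nhds_zero.comp
      tendsto_natCast_atTop_atTop)).comp hsnd).add ((tendsto_ofReal_div_cast
        (variance (fun t : ℝ => t ^ 2) (gaussianReal 0 (σ ^ 2)))).comp hfst))
  rw [ENNReal.ofReal_zero, add_zero, add_zero] at hbound
  refine tendsto_of_tendsto_of_tendsto_of_le_of_le' tendsto_const_nhds hbound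
    (Eventually.of_forall fun _ => bot_le) ?_
  filter_upwards [hfst.eventually (eventually_gt_atTop 0), hsnd.eventually (eventually_gt_atTop 0),
    hratio.eventually (eventually_le_nhds (show δ < 2 * δ by linarith)),
    hratio.eventually (eventually_ge_nhds (show ε + 3 * c < δ by rw [hc]; linarith))]
    with ⟨n, p⟩ hn hp hup hlow
  simp only at hn hp hup hlow
  have hp' : (0 : ℝ) < p := by exact_mod_cast hp
  rw [div_le_iff₀ hp'] at hup
  rw [le_div_iff₀ hp'] at hlow
  refine (modelLaw_exceptional_le hn hp σ hε0 hε1.le hη hη1 hM ha0 (min_le_left _ _)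
    (min_le_right _ _) hL hup hM1 hM2 hM3).trans ?_
  simp only [Function.comp_apply]
  gcongr
  rw [← Real.exp_log (show (0 : ℝ) < 4 by norm_num), ← Real.exp_nat_mul, ← Real.exp_add,
    Real.exp_le_exp]
  have h1 : L * (c * p) ≤ L * (n - (ε + 2 * c) * p) := by
    gcongr
    linarith
  have h2 : L * (c * p) = (Real.log 4 + 2 * δ + 1) * p := by rw [← mul_assoc, hLc]
  linarith

end L0Selection

theorem theorem3p1 (δ ε : ℝ) (σ : ℝ≥0) (hε0 : 0 < ε) (hε1 : ε < 1) (hεδ : ε < δ) :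
    ∃ lam : ℝ → ℝ, (∀ M : ℝ, 0 < M → 0 < lam M) ∧
      ∀ η : ℝ, 0 < η → ∀ᶠ M : ℝ in atTop,
        Tendsto (fun q : ℕ × ℕ =>
            L0Selection.modelLaw q.1 q.2 σ (L0Selection.twoPointPrior ε M)
              {s | ∃ b ∈ L0Selection.l0Argmin (lam M) s.design s.response,
                η ≤ |L0Selection.FDP s.coef b - 0|})
          (L0Selection.proportionalLimit δ) (𝓝 0) ∧
        Tendsto (fun q : ℕ × ℕ =>
            L0Selection.modelLaw q.1 q.2 σ (L0Selection.twoPointPrior ε M)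
              {s | ∃ b ∈ L0Selection.l0Argmin (lam M) s.design s.response,
                η ≤ |L0Selection.TPP s.coef b - 1|})
          (L0Selection.proportionalLimit δ) (𝓝 0) := by
  refine ⟨id, fun M hM => hM, fun η hη => ?_⟩
  filter_upwards [L0Selection.modelLaw_exceptional_tendsto σ hε0 hε1 hεδ (lt_min hη one_pos)
    (min_le_right η 1)] with M hM
  have hmin := min_le_left η 1
  refine ⟨tendsto_of_tendsto_of_tendsto_of_le_of_le tendsto_const_nhds hM (fun _ => bot_le)
    fun q => measure_mono ?_, tendsto_of_tendsto_of_tendsto_of_le_of_le tendsto_const_nhds hM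
    (fun _ => bot_le) fun q => measure_mono ?_⟩
  · rintro s ⟨b, hb, h⟩
    exact ⟨b, hb, fun h' => absurd h'.1 (not_lt.mpr (hmin.trans h))⟩
  · rintro s ⟨b, hb, h⟩
    exact ⟨b, hb, fun h' => absurd h'.2 (not_lt.mpr (hmin.trans h))⟩
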